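/- Let $p$ be a prime, let $n\ge 0$ be an integer, and let $\mathcal F$ be a family of subsets of $[n]=\{1,\dots,n\}$ that is $(p+1)$-wise $p$-divisible, i.e. $|A_1\cap\cdots\cap A_{p+1}|$ is divisible by $p$ for any (not necessarily distinct) $A_1,\dots,A_{p+1}\in\mathcal F$. If $|\mathcal F|>2^{\lfloor n/p\rfloor-1}$, then $\mathcal F$ is contained in an atomic family with atoms of size $p$; that is, there are pairwise disjoint sets $B_1,\dots,B_m\subseteq[n]$ (with $m\ge 0$), each of cardinality $p$, such that $\mathcal F$ is contained in the family of all unions $\bigcup_{i\in I}B_i$, $I\subseteq\{1,\dots,m\}$ (the empty union $\varnothing$ included). -/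

import Mathlib

/-- A family `F` of subsets of an `n`-element set is `k`-wise `l`-divisible if
`|A₁ ∩ ⋯ ∩ A_k|` is divisible by `l` for any, not necessarily distinct,
`A₁, …, A_k ∈ F`. -/
def IsWiseDivisible {n : ℕ} (k l : ℕ) (F : Finset (Finset (Fin n))) : Prop :=
  ∀ A : Fin k → Finset (Fin n), (∀ i, A i ∈ F) → l ∣ (Finset.univ.inf A).card

/-- `G` is the atomic family with set of atoms `atoms`: the atoms are pairwise disjoint, and
`G` consists of all the unions of atoms (the empty union `∅` included). -/
def IsAtomicFamily {n : ℕ} (G atoms : Finset (Finset (Fin n))) : Prop :=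
  (∀ A ∈ atoms, ∀ B ∈ atoms, A ≠ B → Disjoint A B) ∧
    ∀ S : Finset (Fin n), S ∈ G ↔ ∃ B ⊆ atoms, S = B.sup id

/-!
Let `V` be the span of the indicator functions of the members of `F` over an infinite field `K` of
characteristic `p`. The hypothesis says that every function in `V ^ (p + 1)` has coordinate sum
zero. The functions `a` with `a * V ^ (p + 1) ⊆ V ^ (p + 1)` form an algebra, hence are exactly the
functions that are constant on each block of some partition of the ground set. Multiplication by
the indicator function of a block `B` preserves `V ^ (p + 1)`, so the hypothesis passes to the
restriction of `V` to `B`, of dimension `d` say, and there only scalars multiply the `(p + 1)`-st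
power into itself.

Suppose some member of `F` meets `B` in a proper nonempty subset. Kneser's theorem for subspaces
gives `(p + 1) * d ≤ |B| + p`. Moreover the `(p + 2)`-nd power is not contained in the `(p + 1)`-st
one, so some product of `p + 2` indicator functions is not a combination of shorter products; by
inclusion-exclusion all `2 ^ (p + 2) - 1` nonempty Venn regions of these sets are then inhabited,
and `2 ^ (p + 2) ≤ |B| + 1`. Together these give `p * d + p ≤ |B|`. If on the other hand every
member contains or avoids `B`, then either all of them avoid it and `d = 0`, or `d = 1` and `p`
divides `|B|`, so that `|B| = p` or again `p * d + p ≤ |B|`.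

Summing over the blocks, either `p * dim V + p ≤ n`, which contradicts Odlyzko's bound
`|F| ≤ 2 ^ dim V`, or every block that meets a member of `F` has size `p` and is contained in each
member it meets.
-/

open Module
open scoped Pointwise

section Multipliers

variable {K R : Type*} [Field K] [CommRing R] [Algebra K R]

/-- The stabilizer of a subspace `M` in the sense of Kneser's theorem: the algebra of all `a` with
`a * M ⊆ M`. -/
def multiplierAlgebra (M : Submodule K R) : Subalgebra K R :=
  (M / M).toSubalgebra (Submodule.one_mem_div.2 le_rfl) fun a b ha hb m hm => by
    rw [mul_assoc]; exact ha _ (hb m hm)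

theorem mem_multiplierAlgebra {M : Submodule K R} {a : R} :
    a ∈ multiplierAlgebra M ↔ ∀ m ∈ M, a * m ∈ M :=
  Submodule.mem_div_iff_forall_mul_mem

theorem multiplierAlgebra_le_mul (V W : Submodule K R) :
    multiplierAlgebra V ≤ multiplierAlgebra (V * W) := by
  change V / V ≤ (V * W) / (V * W)
  rw [Submodule.le_div_iff_mul_le, ← mul_assoc]
  gcongr
  exact Submodule.le_div_iff_mul_le.1 le_rfl

theorem multiplierAlgebra_pow_mono (V : Submodule K R) :
    Monotone fun t : ℕ => multiplierAlgebra (V ^ t) :=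
  monotone_nat_of_le_succ fun t => by
    simpa only [pow_succ] using multiplierAlgebra_le_mul (V ^ t) V

theorem finrank_le_one_of_le_one {V : Submodule K R} (hV : V ≤ 1) : finrank K V ≤ 1 := by
  rw [Submodule.one_eq_span] at hV
  exact (Submodule.finrank_mono hV).trans <| (finrank_span_le_card {(1 : R)}).trans (by simp)

theorem mem_inv_units_smul {u : Rˣ} {a : R} {B : Submodule K R} :
    a ∈ u⁻¹ • B ↔ u * a ∈ B where
  mp := by
    rintro ⟨b, hb, rfl⟩
    exact (u.mul_inv_cancel_left b).symm ▸ hb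
  mpr h := ⟨_, h, u.inv_mul_cancel_left a⟩

theorem finrank_units_smul (u : Rˣ) (A : Submodule K R) :
    finrank K (u • A : Submodule K R) = finrank K A :=
  (DistribMulAction.toLinearEquiv K R u).finrank_map_eq A

theorem finrank_inf_smul_add_finrank_sup_smul [FiniteDimensional K R] (u : Rˣ)
    (A B : Submodule K R) :
    finrank K (A ⊓ u⁻¹ • B : Submodule K R) + finrank K (B ⊔ u • A : Submodule K R) =
      finrank K A + finrank K B := by
  have h : u • (A ⊓ u⁻¹ • B) = B ⊓ u • A := by
    rw [inf_comm B]
    conv_rhs => rw [← smul_inv_smul u B]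
    exact Submodule.map_inf _ (DistribMulAction.toLinearEquiv K R u).injective
  rw [← finrank_units_smul u (A ⊓ _), h, add_comm, Submodule.finrank_sup_add_finrank_inf_eq,
    finrank_units_smul, add_comm]

theorem inf_smul_mul_sup_smul_le (u : Rˣ) (A B : Submodule K R) :
    (A ⊓ u⁻¹ • B) * (B ⊔ u • A) ≤ A * B := by
  rw [Submodule.mul_sup]
  refine sup_le (mul_le_mul_left inf_le_left B) ?_
  calc (A ⊓ u⁻¹ • B) * (u • A) ≤ (u⁻¹ • B) * (u • A) := mul_le_mul_left inf_le_right _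
    _ = A * B := by rw [smul_mul_assoc, mul_smul_comm, inv_smul_smul, mul_comm]

end Multipliers

section Kneser

variable {K α : Type*} [Field K]

theorem indicator_preimage_singleton_mem [Finite α] (S : Subalgebra K (α → K)) {f : α → K}
    (hf : f ∈ S) (c : K) : (f ⁻¹' {c}).indicator 1 ∈ S := by
  classical
  have := Fintype.ofFinite α
  let P := Lagrange.basis (insert c (Finset.univ.image f)) id c
  have h : (f ⁻¹' {c}).indicator 1 = Polynomial.aeval f P := by
    funext x
    rw [Polynomial.aeval_fn_apply, Polynomial.coe_aeval_eq_eval]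
    by_cases hx : f x = c
    · simpa [hx] using
        (Lagrange.eval_basis_self (v := id) Function.injective_id.injOn (by simp)).symm
    · rw [Set.indicator_of_notMem (by simpa using hx)]
      exact (Lagrange.eval_basis_of_ne (v := id) (Ne.symm hx) (by simp)).symm
  exact h ▸ Algebra.adjoin_singleton_le hf (Polynomial.aeval_mem_adjoin_singleton K f)

theorem exists_ne_of_notMem_bot {f : α → K} (hf : f ∉ (⊥ : Subalgebra K (α → K))) :
    ∃ x y, f x ≠ f y := by
  contrapose! hf
  rw [Algebra.mem_bot]
  cases isEmpty_or_nonempty α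
  · exact ⟨0, Subsingleton.elim _ _⟩
  · exact ⟨f (Classical.arbitrary α), funext fun x => hf _ x⟩

theorem exists_indicator_mem_notMem_bot [Finite α] {S : Subalgebra K (α → K)} (hS : S ≠ ⊥) :
    ∃ s : Set α, s.indicator 1 ∈ S ∧ s.indicator 1 ∉ (⊥ : Subalgebra K (α → K)) := by
  obtain ⟨f, hf, hfbot⟩ : ∃ f ∈ S, f ∉ (⊥ : Subalgebra K (α → K)) :=
    SetLike.not_le_iff_exists.1 fun hle => hS (le_bot_iff.1 hle)
  obtain ⟨x, y, hxy⟩ := exists_ne_of_notMem_bot hfbot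
  refine ⟨f ⁻¹' {f x}, indicator_preimage_singleton_mem S hf (f x), fun hbot => ?_⟩
  obtain ⟨c, hc⟩ := Algebra.mem_bot.1 hbot
  have hcx : c = 1 := by simpa using congrFun hc x
  have hcy : c = 0 := by simpa [Ne.symm hxy] using congrFun hc y
  exact one_ne_zero (hcx.symm.trans hcy)

/-- The functions in `V` have no common zero. Over an infinite field this is the condition under
which `V` contains units, as Kneser's theorem requires. -/
def HasNoCommonZero (V : Submodule K (α → K)) : Prop :=
  ∀ x, ∃ f ∈ V, f x ≠ 0

theorem HasNoCommonZero.mono {V W : Submodule K (α → K)} (hV : HasNoCommonZero V) (h : V ≤ W) :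
    HasNoCommonZero W := fun x =>
  (hV x).imp fun _ hf => ⟨h hf.1, hf.2⟩

theorem HasNoCommonZero.pow {V : Submodule K (α → K)} (hV : HasNoCommonZero V) (t : ℕ) :
    HasNoCommonZero (V ^ t) := fun x => by
  obtain ⟨f, hf, hfx⟩ := hV x
  exact ⟨f ^ t, Submodule.pow_mem_pow V hf t, pow_ne_zero t hfx⟩

theorem hasNoCommonZero_of_multiplierAlgebra_eq_bot [Nontrivial α] {V : Submodule K (α → K)}
    (hV : multiplierAlgebra V = ⊥) : HasNoCommonZero V := fun x => by
  classical
  by_contra! hx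
  have hmem : Pi.single x 1 ∈ multiplierAlgebra V := mem_multiplierAlgebra.2 fun f hf => by
    have : Pi.single x 1 * f = 0 := by
      rw [← Pi.single_mul_left]
      simp [hx f hf]
    exact this ▸ V.zero_mem
  obtain ⟨c, hc⟩ := Algebra.mem_bot.1 (hV ▸ hmem)
  obtain ⟨y, hy⟩ := exists_ne x
  have hcx : c = 1 := by simpa using congrFun hc x
  have hcy : c = 0 := by simpa [hy] using congrFun hc y
  exact one_ne_zero (hcx.symm.trans hcy)

-- A vector space over an infinite field is not a finite union of proper subspaces.
theorem HasNoCommonZero.exists_isUnit_forall_notMem [Finite α] [Infinite K]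
    {V : Submodule K (α → K)} (hV : HasNoCommonZero V) (s : Finset (Submodule K (α → K)))
    (hs : ∀ U ∈ s, ¬ V ≤ U) : ∃ v ∈ V, IsUnit v ∧ ∀ U ∈ s, v ∉ U := by
  classical
  have := Fintype.ofFinite α
  let vanishingAt (x : α) : Submodule K (α → K) := LinearMap.ker (LinearMap.proj x)
  let bad := s ∪ Finset.univ.image vanishingAt
  have hbad : ∀ U ∈ bad, ¬ V ≤ U := by
    intro U hU hle
    rcases Finset.mem_union.1 hU with hU | hU
    · exact hs U hU hle
    · obtain ⟨x, -, rfl⟩ := Finset.mem_image.1 hU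
      obtain ⟨f, hf, hfx⟩ := hV x
      exact hfx (hle hf)
  have hproper : (⊤ : Submodule K V) ∉ bad.image (Submodule.comap V.subtype) := by
    simpa only [Finset.mem_image, Submodule.comap_subtype_eq_top, not_exists, not_and] using hbad
  obtain ⟨v, hv⟩ := (Set.ne_univ_iff_exists_notMem _).1
    (Subspace.biUnion_ne_univ_of_top_notMem hproper)
  have hv : ∀ U ∈ bad, (v : α → K) ∉ U := by simpa using hv
  refine ⟨v, v.2, Pi.isUnit_iff.2 fun x => isUnit_iff_ne_zero.2 fun hx => ?_, fun U hU => ?_⟩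
  · exact hv (vanishingAt x)
      (Finset.mem_union_right _ (Finset.mem_image_of_mem _ (Finset.mem_univ x))) hx
  · exact hv U (Finset.mem_union_left _ hU)

theorem exists_le_mul_and_finrank_add_finrank_le [Finite α] [Infinite K] (A B : Submodule K (α → K))
    (hA : 1 ∈ A) (hB : HasNoCommonZero B) :
    ∃ M, B ≤ M ∧ M ≤ A * B ∧
      (finrank K A + finrank K B ≤ finrank K M + 1 ∨ multiplierAlgebra M ≠ ⊥) := by
  induction hd : finrank K A using Nat.strong_induction_on generalizing A B with
  | _ d ih =>
  subst hd
  have hBAB : B ≤ A * B := fun b hb => one_mul b ▸ Submodule.mul_mem_mul hA hb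
  by_cases hAB : A * B ≤ B
  · refine ⟨B, le_rfl, hBAB, or_iff_not_imp_right.2 fun hbot => ?_⟩
    have hA1 : A ≤ 1 := by
      rw [← Algebra.toSubmodule_bot, ← not_not.1 hbot]
      exact Submodule.le_div_iff_mul_le.2 hAB
    have := finrank_le_one_of_le_one hA1
    omega
  · -- The Dyson transform: `A ⊓ u⁻¹ • B` and `B ⊔ u • A` have the same total dimension as `A`
    -- and `B`, and their product is still contained in `A * B`.
    obtain ⟨a, ha, b₀, hb₀, hab₀⟩ : ∃ a ∈ A, ∃ b ∈ B, a * b ∉ B := by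
      simpa [Submodule.mul_le] using hAB
    obtain ⟨b, hb, ⟨u, rfl⟩, hab⟩ := hB.exists_isUnit_forall_notMem
      {B.comap (LinearMap.mulLeft K a)} (by simpa using fun hle => hab₀ (hle hb₀))
    have hlt : A ⊓ u⁻¹ • B < A := by
      refine inf_le_left.lt_of_not_ge fun hle => hab _ (Finset.mem_singleton_self _) ?_
      exact (mul_comm _ a ▸ mem_inv_units_smul.1 (hle ha).2 : a * u ∈ B)
    have h1 : 1 ∈ u⁻¹ • B := mem_inv_units_smul.2 ((mul_one (u : α → K)).symm ▸ hb)
    obtain ⟨M, hBM, hMAB, hM⟩ := ih _ (Submodule.finrank_lt_finrank_of_lt hlt) (A ⊓ u⁻¹ • B)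
      (B ⊔ u • A) ⟨hA, h1⟩ (hB.mono le_sup_left) rfl
    exact ⟨M, le_sup_left.trans hBM, hMAB.trans (inf_smul_mul_sup_smul_le u A B),
      finrank_inf_smul_add_finrank_sup_smul u A B ▸ hM⟩

theorem finrank_add_finrank_le_of_multiplierAlgebra_mul_eq_bot [Finite α] [Infinite K]
    {V W : Submodule K (α → K)} (hV : HasNoCommonZero V) (hW : HasNoCommonZero W)
    (hVW : multiplierAlgebra (V * W) = ⊥) :
    finrank K V + finrank K W ≤ finrank K (V * W : Submodule K (α → K)) + 1 := by
  classical
  have := Fintype.ofFinite α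
  -- The unit `u ∈ V` is chosen so that no nonconstant indicator function multiplies `u • W` into
  -- `V * W`; then none can stabilize a subspace between the two.
  let bad (s : Set α) : Submodule K (α → K) :=
    ((V * W) / W).comap (LinearMap.mulLeft K (s.indicator 1))
  let nontrivialSets : Finset (Set α) := {s | s.indicator 1 ∉ (⊥ : Subalgebra K (α → K))}
  have hbad : ∀ U ∈ nontrivialSets.image bad, ¬ V ≤ U := by
    rintro U hU hle
    obtain ⟨s, hs, rfl⟩ := Finset.mem_image.1 hU
    refine (Finset.mem_filter.1 hs).2 (hVW ▸ mem_multiplierAlgebra.2 fun f hf => ?_)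
    induction hf using Submodule.mul_induction_on' with
    | mem_mul_mem v hv w hw => exact mul_assoc _ v w ▸ hle hv w hw
    | add f _ g _ hf hg => exact mul_add _ f g ▸ add_mem hf hg
  obtain ⟨_, hu, ⟨u, rfl⟩, hunot⟩ := hV.exists_isUnit_forall_notMem _ hbad
  have hprod : (u⁻¹ • V) * (u • W) = V * W := by
    rw [smul_mul_assoc, mul_smul_comm, inv_smul_smul]
  have h1 : 1 ∈ u⁻¹ • V := mem_inv_units_smul.2 ((mul_one (u : α → K)).symm ▸ hu)
  have huW : HasNoCommonZero (u • W) := fun x => by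
    obtain ⟨w, hw, hwx⟩ := hW x
    exact ⟨u • w, Submodule.smul_mem_pointwise_smul w u W hw,
      mul_ne_zero (Pi.isUnit_iff.1 u.isUnit x).ne_zero hwx⟩
  obtain ⟨M, hWM, hMVW, hM | hM⟩ :=
    exists_le_mul_and_finrank_add_finrank_le (u⁻¹ • V) (u • W) h1 huW
  · rw [finrank_units_smul, finrank_units_smul] at hM
    exact hM.trans (Nat.succ_le_succ (Submodule.finrank_mono (hprod ▸ hMVW)))
  · obtain ⟨s, hsM, hs⟩ := exists_indicator_mem_notMem_bot hM
    have hs' : bad s ∈ nontrivialSets.image bad :=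
      Finset.mem_image_of_mem _ (Finset.mem_filter.2 ⟨Finset.mem_univ s, hs⟩)
    refine absurd (fun w hw => ?_) (hunot (bad s) hs')
    rw [LinearMap.mulLeft_apply, mul_assoc]
    exact hprod ▸ hMVW (mem_multiplierAlgebra.1 hsM _
      (hWM (Submodule.smul_mem_pointwise_smul w u W hw)))

theorem succ_mul_finrank_le_of_multiplierAlgebra_pow_eq_bot [Finite α] [Infinite K]
    {V : Submodule K (α → K)} (hV : HasNoCommonZero V) (t : ℕ)
    (ht : multiplierAlgebra (V ^ (t + 1)) = ⊥) :
    (t + 1) * finrank K V ≤ finrank K (V ^ (t + 1) : Submodule K (α → K)) + t := by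
  induction t with
  | zero => rw [zero_add, one_mul, pow_one, add_zero]
  | succ t ih =>
    have ht' : multiplierAlgebra (V ^ (t + 1)) = ⊥ :=
      le_bot_iff.1 (ht ▸ multiplierAlgebra_pow_mono V (t + 1).le_succ)
    have hstep := finrank_add_finrank_le_of_multiplierAlgebra_mul_eq_bot (hV.pow (t + 1)) hV
      (by rwa [← pow_succ])
    rw [← pow_succ] at hstep
    linarith [ih ht']

end Kneser

section Idempotents

variable {K α : Type*} [Field K]

theorem isIdempotentElem_pi_iff {e : α → K} : IsIdempotentElem e ↔ ∀ x, e x = 0 ∨ e x = 1 := by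
  simp only [IsIdempotentElem, funext_iff, Pi.mul_apply]
  exact forall_congr' fun x => IsIdempotentElem.iff_eq_zero_or_one

theorem eq_zero_or_eq_one_of_mem_bot {R : Type*} [CommRing R] [Algebra K R] {e : R}
    (he : IsIdempotentElem e) (hbot : e ∈ (⊥ : Subalgebra K R)) : e = 0 ∨ e = 1 := by
  obtain ⟨c, rfl⟩ := Algebra.mem_bot.1 hbot
  rcases eq_or_ne c 0 with rfl | hc
  · exact .inl (map_zero _)
  · exact .inr ((hc.isUnit.map (algebraMap K R)).mul_left_cancel (he.trans (mul_one _).symm))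

theorem exists_le_finrank_forall_eq_of_comp_eq [Finite α] (V : Submodule K (α → K)) :
    ∃ n ≤ finrank K V, ∃ x : Fin n → α, ∀ f ∈ V, ∀ g ∈ V, f ∘ x = g ∘ x → f = g := by
  let eval (x : α) : Dual K V := LinearMap.proj x ∘ₗ V.subtype
  obtain ⟨φ, hφ, hspan, -⟩ := Submodule.exists_fun_fin_finrank_span_eq K (Set.range eval)
  choose x hx using hφ
  refine ⟨_, (Submodule.finrank_le _).trans_eq Subspace.dual_finrank_eq, x,
    fun f hf g hg hfg => ?_⟩
  let difference : V := ⟨f - g, sub_mem hf hg⟩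
  have hker : Submodule.span K (Set.range eval) ≤ LinearMap.ker (Dual.eval K V difference) := by
    rw [← hspan, Submodule.span_le]
    rintro _ ⟨i, rfl⟩
    rw [← hx]
    exact sub_eq_zero.2 (congrFun hfg i)
  exact funext fun y => sub_eq_zero.1 (hker (Submodule.subset_span ⟨y, rfl⟩))

theorem card_le_two_pow_finrank [Finite α] {V : Submodule K (α → K)} {s : Finset (α → K)}
    (hsV : ↑s ⊆ (V : Set (α → K))) (hs : ∀ e ∈ s, IsIdempotentElem e) :
    s.card ≤ 2 ^ finrank K V := by
  classical
  obtain ⟨n, hn, x, hx⟩ := exists_le_finrank_forall_eq_of_comp_eq V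
  let ones (f : α → K) : Finset (Fin n) := {i | f (x i) = 1}
  have hinj : Set.InjOn ones s := by
    refine fun f hf g hg hfg => hx f (hsV hf) g (hsV hg) (funext fun i => ?_)
    have hiff : f (x i) = 1 ↔ g (x i) = 1 := by simpa [ones] using Finset.ext_iff.1 hfg i
    have hf01 := isIdempotentElem_pi_iff.1 (hs f hf) (x i)
    have hg01 := isIdempotentElem_pi_iff.1 (hs g hg) (x i)
    grind
  calc s.card ≤ (Finset.univ : Finset (Finset (Fin n))).card :=
        Finset.card_le_card_of_injOn ones (fun _ _ => Finset.mem_univ _) hinj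
    _ = 2 ^ n := by rw [Finset.card_univ, Fintype.card_finset, Fintype.card_fin]
    _ ≤ 2 ^ finrank K V := Nat.pow_le_pow_right two_pos hn

theorem prod_mul_prod_compl_one_sub_ne_zero {R ι : Type*} [CommRing R] [Fintype ι]
    [DecidableEq ι] {W : AddSubgroup R} {e : ι → R} (he : ∏ i, e i ∉ W)
    (hW : ∀ S : Finset ι, S.Nonempty → S ≠ Finset.univ → ∏ i ∈ S, e i ∈ W) {S : Finset ι}
    (hS : S.Nonempty) : (∏ i ∈ S, e i) * ∏ i ∈ Sᶜ, (1 - e i) ≠ 0 := by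
  -- In the expansion of the second factor, every term but the last one lies in `W`.
  have hterm (T) (hT : T ∈ Sᶜ.powerset) : (∏ i ∈ S, e i) * ∏ i ∈ T, e i = ∏ i ∈ S ∪ T, e i :=
    (Finset.prod_union (Finset.disjoint_right.2 fun i hi =>
      Finset.mem_compl.1 (Finset.mem_powerset.1 hT hi))).symm
  have hexpand : (∏ i ∈ S, e i) * ∏ i ∈ Sᶜ, (1 - e i) =
      ∑ T ∈ Sᶜ.powerset, (-1) ^ T.card * ∏ i ∈ S ∪ T, e i := by
    simp only [Finset.prod_sub, Finset.prod_const_one, mul_one, Finset.mul_sum]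
    exact Finset.sum_congr rfl fun T hT => by rw [mul_left_comm, hterm T hT]
  have hrest : ∑ T ∈ Sᶜ.powerset.erase Sᶜ, (-1) ^ T.card * ∏ i ∈ S ∪ T, e i ∈ W := by
    refine sum_mem fun T hT => ?_
    obtain ⟨hne, hsub⟩ := Finset.mem_erase.1 hT
    have hmem : ∏ i ∈ S ∪ T, e i ∈ W := hW _ (hS.mono Finset.subset_union_left) fun huniv =>
      hne (le_antisymm (Finset.mem_powerset.1 hsub)
        (codisjoint_iff_compl_le_right.1 (codisjoint_iff.2 huniv)))
    rcases neg_one_pow_eq_or R T.card with h | h <;> simpa [h] using hmem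
  intro hzero
  rw [hexpand, ← Finset.add_sum_erase _ _ (Finset.mem_powerset_self _), Finset.union_compl] at hzero
  have hfull : (-1) ^ Sᶜ.card * ∏ i, e i ∈ W :=
    (add_mem_cancel_right hrest).1 (hzero ▸ W.zero_mem)
  rcases neg_one_pow_eq_or R Sᶜ.card with h | h <;> exact he (by simpa [h] using hfull)

theorem monotone_span_pow_succ {R : Type*} [CommRing R] [Algebra K R] {s : Set R}
    (hs : ∀ e ∈ s, IsIdempotentElem e) : Monotone fun t : ℕ => Submodule.span K s ^ (t + 1) :=
  monotone_nat_of_le_succ fun t => by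
    have hsq : Submodule.span K s ≤ Submodule.span K s * Submodule.span K s :=
      Submodule.span_le.2 fun e he => (hs e he).eq ▸
        Submodule.mul_mem_mul (Submodule.subset_span he) (Submodule.subset_span he)
    rw [pow_succ, pow_succ _ (t + 1), pow_succ _ t, mul_assoc]
    gcongr

theorem prod_mem_span_pow {R ι : Type*} [CommRing R] [Algebra K R] {s : Set R}
    (hs : ∀ e ∈ s, IsIdempotentElem e) {e : ι → R} (he : ∀ i, e i ∈ s) {S : Finset ι}
    (hS : S.Nonempty) {t : ℕ} (ht : S.card ≤ t) : ∏ i ∈ S, e i ∈ Submodule.span K s ^ t := by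
  have hmem : ∏ i ∈ S, e i ∈ Submodule.span K s ^ S.card := by
    rw [← Finset.prod_const, Submodule.prod_span]
    exact Submodule.subset_span (Set.finsetProd_mem_finsetProd S _ e fun i _ => he i)
  have hpos := hS.card_pos
  obtain ⟨k, hk⟩ : ∃ k, S.card = k + 1 := Nat.exists_eq_add_one.2 hpos
  obtain ⟨l, rfl⟩ : ∃ l, t = l + 1 := Nat.exists_eq_add_one.2 (hpos.trans_le ht)
  rw [hk] at hmem ht
  exact monotone_span_pow_succ hs (Nat.succ_le_succ_iff.1 ht) hmem

theorem two_pow_card_le_card_add_one [Fintype α] {ι : Type*} [Fintype ι] [DecidableEq ι]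
    {e : ι → α → K} (he : ∀ i, IsIdempotentElem (e i))
    (hvenn : ∀ S : Finset ι, S.Nonempty → (∏ i ∈ S, e i) * ∏ i ∈ Sᶜ, (1 - e i) ≠ 0) :
    2 ^ Fintype.card ι ≤ Fintype.card α + 1 := by
  classical
  let code : Option α → Finset ι := fun
    | none => ∅
    | some x => {i | e i x = 1}
  have hcode : Function.Surjective code := fun S => by
    rcases S.eq_empty_or_nonempty with rfl | hS
    · exact ⟨none, rfl⟩
    obtain ⟨x, hx⟩ := Function.ne_iff.1 (hvenn S hS)
    simp only [Pi.mul_apply, Finset.prod_apply, Pi.zero_apply, mul_ne_zero_iff,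
      Finset.prod_ne_zero_iff, Finset.mem_compl, Pi.sub_apply, Pi.one_apply, sub_ne_zero] at hx
    refine ⟨some x, Finset.ext fun i => ?_⟩
    rw [Finset.mem_filter_univ]
    refine ⟨fun hi => by_contra fun hiS => hx.2 i hiS hi.symm, fun hi => ?_⟩
    exact (isIdempotentElem_pi_iff.1 (he i) x).resolve_left (hx.1 i hi)
  simpa using Fintype.card_le_of_surjective code hcode

theorem two_pow_le_card_add_one_of_not_span_pow_succ_le [Fintype α] {s : Set (α → K)}
    (hs : ∀ e ∈ s, IsIdempotentElem e) {t : ℕ}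
    (ht : ¬ Submodule.span K s ^ (t + 1) ≤ Submodule.span K s ^ t) :
    2 ^ (t + 1) ≤ Fintype.card α + 1 := by
  obtain ⟨e, hes, he⟩ : ∃ e : Fin (t + 1) → α → K,
      (∀ i, e i ∈ s) ∧ ∏ i, e i ∉ Submodule.span K s ^ t := by
    rw [Submodule.span_pow s (t + 1), Submodule.span_le, Set.not_subset] at ht
    obtain ⟨_, hmem, hnot⟩ := ht
    obtain ⟨e, hes, rfl⟩ := Set.mem_pow_iff_prod.1 hmem
    exact ⟨e, hes, hnot⟩
  have hproper (S : Finset (Fin (t + 1))) (hne : S.Nonempty) (hS : S ≠ Finset.univ) :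
      ∏ i ∈ S, e i ∈ Submodule.span K s ^ t := by
    refine prod_mem_span_pow hs hes hne (Nat.lt_succ_iff.1 ?_)
    simpa using Finset.card_lt_card (Finset.ssubset_univ_iff.2 hS)
  simpa using two_pow_card_le_card_add_one (fun i => hs _ (hes i)) fun S =>
    prod_mul_prod_compl_one_sub_ne_zero (W := (Submodule.span K s ^ t).toAddSubgroup) he hproper

theorem sq_lt_two_pow_succ (t : ℕ) : t ^ 2 < 2 ^ (t + 1) := by
  induction t with
  | zero => norm_num
  | succ t ih =>
    have := Nat.lt_two_pow_self (n := t)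
    calc (t + 1) ^ 2 = t ^ 2 + 2 * t + 1 := by ring
      _ < 2 ^ (t + 1) + 2 * 2 ^ t := by omega
      _ = 2 ^ (t + 1 + 1) := by ring

theorem forall_eq_zero_or_eq_one_or_mul_finrank_span_add_le_card [Infinite K] [Fintype α]
    {s : Set (α → K)} (hs : ∀ e ∈ s, IsIdempotentElem e) (t : ℕ)
    (ht : multiplierAlgebra (Submodule.span K s ^ (t + 1)) = ⊥) :
    (∀ e ∈ s, e = 0 ∨ e = 1) ∨
      t * finrank K (Submodule.span K s) + t ≤ Fintype.card α := by
  refine or_iff_not_imp_left.2 fun hne => ?_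
  obtain ⟨e, hes, hnot⟩ : ∃ e ∈ s, ¬ (e = 0 ∨ e = 1) := by
    simpa only [not_forall, exists_prop] using hne
  set V := Submodule.span K s
  have hbot : e ∉ (⊥ : Subalgebra K (α → K)) := mt (eq_zero_or_eq_one_of_mem_bot (hs e hes)) hnot
  have hgrow : ¬ V ^ (t + 1 + 1) ≤ V ^ (t + 1) := fun hle =>
    hbot <| ht ▸ mem_multiplierAlgebra.2 fun f hf =>
      hle (pow_succ' V (t + 1) ▸ Submodule.mul_mem_mul (Submodule.subset_span hes) hf)
  have hexp := two_pow_le_card_add_one_of_not_span_pow_succ_le hs hgrow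
  have hzero : HasNoCommonZero V := by
    obtain ⟨x, y, hxy⟩ := exists_ne_of_notMem_bot hbot
    have : Nontrivial α := ⟨x, y, fun h => hxy (h ▸ rfl)⟩
    refine hasNoCommonZero_of_multiplierAlgebra_eq_bot (le_bot_iff.1 ?_)
    simpa [ht] using multiplierAlgebra_pow_mono V t.succ_pos
  have hkneser := succ_mul_finrank_le_of_multiplierAlgebra_pow_eq_bot hzero t ht
  have hcard : finrank K (V ^ (t + 1) : Submodule K (α → K)) ≤ Fintype.card α :=
    (Submodule.finrank_le _).trans_eq (finrank_fintype_fun_eq_card K)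
  -- If `2 * t ≤ dim V`, Kneser's bound suffices; otherwise `t * (dim V + 1) ≤ 2 * t ^ 2` does.
  have hsq := sq_lt_two_pow_succ t
  rcases le_or_gt (2 * t) (finrank K V) with hd | hd
  · linarith
  · have : t * (finrank K V + 1) ≤ t * (2 * t) := Nat.mul_le_mul_left t hd
    rw [pow_succ] at hexp
    nlinarith

theorem mul_finrank_span_add_le_card_or_forall_eq_zero_or_eq_one [Infinite K] [Fintype α]
    [Nonempty α] (p : ℕ) [CharP K p] {s : Set (α → K)}
    (hs : ∀ e ∈ s, IsIdempotentElem e)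
    (hsum : ∀ f ∈ Submodule.span K s ^ (p + 1), ∑ x, f x = 0)
    (hbot : multiplierAlgebra (Submodule.span K s ^ (p + 1)) = ⊥) :
    p * finrank K (Submodule.span K s) + p ≤ Fintype.card α ∨
      p * finrank K (Submodule.span K s) ≤ Fintype.card α ∧
        ∀ e ∈ s, e = 0 ∨ e = 1 ∧ Fintype.card α = p := by
  rcases forall_eq_zero_or_eq_one_or_mul_finrank_span_add_le_card hs p hbot with htriv | hle
  swap
  · exact .inl hle
  by_cases hone : 1 ∈ s
  · have hdvd : p ∣ Fintype.card α := by
      have := hsum 1 (one_pow (M := α → K) (p + 1) ▸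
        Submodule.pow_mem_pow _ (Submodule.subset_span hone) (p + 1))
      simpa [CharP.cast_eq_zero_iff K p] using this
    have hfin : finrank K (Submodule.span K s) ≤ 1 :=
      finrank_le_one_of_le_one <| Submodule.span_le.2 fun e he => by
        rcases htriv e he with rfl | rfl
        · exact zero_mem _
        · exact Submodule.one_le.1 le_rfl
    have hmul : p * finrank K (Submodule.span K s) ≤ p := by nlinarith
    obtain ⟨k, hk⟩ := hdvd
    have hk0 : k ≠ 0 := by
      rintro rfl
      exact Fintype.card_ne_zero hk
    rcases eq_or_ne k 1 with rfl | hk1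
    · rw [mul_one] at hk
      exact .inr ⟨hk ▸ hmul, fun e he => (htriv e he).imp_right fun h => ⟨h, hk⟩⟩
    · have : p * 2 ≤ p * k := Nat.mul_le_mul_left p (by omega)
      exact .inl (by omega)
  · have hzero : ∀ e ∈ s, e = 0 := fun e he =>
      (htriv e he).resolve_right fun h => hone (h ▸ he)
    have hspan : Submodule.span K s = ⊥ := Submodule.span_eq_bot.2 hzero
    refine .inr ⟨?_, fun e he => .inl (hzero e he)⟩
    rw [hspan, finrank_bot, mul_zero]
    exact Nat.zero_le _

end Idempotents

section Blocks

variable {K α : Type*} [Field K]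

/-- Restriction of functions to `B`, as a homomorphism of algebras, so that it commutes with forming
powers of subspaces. -/
def restrictAlgHom (K : Type*) {α : Type*} [Field K] (B : Finset α) : (α → K) →ₐ[K] (B → K) :=
  AlgHom.pi fun x => Pi.evalAlgHom K (fun _ => K) x.1

@[simp]
theorem restrictAlgHom_apply (B : Finset α) (f : α → K) (x : B) : restrictAlgHom K B f x = f x :=
  rfl

variable [Fintype α] [DecidableEq α]

open Classical in
/-- The partition of `α` whose parts are the maximal sets on which every function in `S` is
constant, i.e. the points of the spectrum of `S`. -/
noncomputable def blockPartition (S : Subalgebra K (α → K)) :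
    Finpartition (Finset.univ : Finset α) :=
  .ofSetoid (Setoid.ker fun x (f : S) => f.1 x)

theorem mem_part_blockPartition {S : Subalgebra K (α → K)} {x y : α} :
    y ∈ (blockPartition S).part x ↔ ∀ f ∈ S, f x = f y := by
  simp only [blockPartition, Finpartition.mem_part_ofSetoid_iff_rel, Setoid.ker_def, funext_iff,
    Subtype.forall]

theorem eq_of_mem_blockPartition {S : Subalgebra K (α → K)} {B : Finset α}
    (hB : B ∈ (blockPartition S).parts) {f : α → K} (hf : f ∈ S) {x y : α} (hx : x ∈ B)
    (hy : y ∈ B) : f x = f y := by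
  rw [← (blockPartition S).part_eq_of_mem hB hx] at hy
  exact mem_part_blockPartition.1 hy f hf

theorem indicator_mem_of_mem_blockPartition {S : Subalgebra K (α → K)} {B : Finset α}
    (hB : B ∈ (blockPartition S).parts) : (B : Set α).indicator 1 ∈ S := by
  obtain ⟨x, hx⟩ := (blockPartition S).nonempty_of_mem_parts hB
  have hsep : ∀ y ∈ Bᶜ, ∃ f ∈ S, f x ≠ f y := fun y hy => by
    simpa only [not_forall, exists_prop, ← (blockPartition S).part_eq_of_mem hB hx,
      mem_part_blockPartition, Finset.mem_compl] using hy
  choose! f hfS hfne using hsep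
  have hprod : (B : Set α).indicator 1 = ∏ y ∈ Bᶜ, (f y ⁻¹' {f y x}).indicator (1 : α → K) := by
    funext z
    rw [Finset.prod_apply]
    by_cases hz : z ∈ B
    · rw [Set.indicator_of_mem (Finset.mem_coe.2 hz)]
      exact (Finset.prod_eq_one fun y hy => Set.indicator_of_mem
        (s := f y ⁻¹' {f y x}) (eq_of_mem_blockPartition hB (hfS y hy) hz hx) _).symm
    · rw [Set.indicator_of_notMem (mt Finset.mem_coe.1 hz)]
      have hzB := Finset.mem_compl.2 hz
      refine (Finset.prod_eq_zero hzB ?_).symm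
      exact Set.indicator_of_notMem (s := f z ⁻¹' {f z x}) (hfne z hzB).symm _
  exact hprod ▸ prod_mem fun y hy => indicator_preimage_singleton_mem S (hfS y hy) _

theorem multiplierAlgebra_map_restrictAlgHom_eq_bot {W : Submodule K (α → K)} {B : Finset α}
    (hB : B ∈ (blockPartition (multiplierAlgebra W)).parts) :
    multiplierAlgebra (W.map (restrictAlgHom K B).toLinearMap) = ⊥ := by
  refine eq_bot_iff.2 fun g hg => by_contra fun hbot => ?_
  obtain ⟨x, y, hxy⟩ := exists_ne_of_notMem_bot hbot
  let extension : α → K := fun z => if hz : z ∈ B then g ⟨z, hz⟩ else 0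
  have hmem : extension ∈ multiplierAlgebra W := mem_multiplierAlgebra.2 fun w hw => by
    obtain ⟨w', hw', heq⟩ := mem_multiplierAlgebra.1 hg _ ⟨w, hw, rfl⟩
    have : extension * w = (B : Set α).indicator 1 * w' := by
      funext z
      by_cases hz : z ∈ B
      · simpa [extension, hz] using (congrFun heq ⟨z, hz⟩).symm
      · simp [extension, hz]
    exact this ▸ mem_multiplierAlgebra.1 (indicator_mem_of_mem_blockPartition hB) w' hw'
  exact hxy (by simpa [extension] using eq_of_mem_blockPartition hB hmem x.2 y.2)

theorem sum_eq_zero_of_mem_map_restrictAlgHom {W : Submodule K (α → K)}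
    (hW : ∀ f ∈ W, ∑ x, f x = 0) {B : Finset α}
    (hB : B ∈ (blockPartition (multiplierAlgebra W)).parts) {g : B → K}
    (hg : g ∈ W.map (restrictAlgHom K B).toLinearMap) : ∑ x, g x = 0 := by
  obtain ⟨f, hf, rfl⟩ := hg
  calc ∑ x : B, f x = ∑ x, ((B : Set α).indicator (1 : α → K) * f) x := by
        rw [Finset.sum_coe_sort B f, ← Finset.sum_indicator_subset f B.subset_univ]
        simp [Set.indicator_apply]
    _ = 0 := hW _ (mem_multiplierAlgebra.1 (indicator_mem_of_mem_blockPartition hB) f hf)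

theorem finrank_le_sum_finrank_map_restrictAlgHom
    (P : Finpartition (Finset.univ : Finset α)) (V : Submodule K (α → K)) :
    finrank K V ≤ ∑ B ∈ P.parts, finrank K (V.map (restrictAlgHom K B).toLinearMap) := by
  let restriction : V →ₗ[K] ∀ B : P.parts, V.map (restrictAlgHom K B.1).toLinearMap :=
    LinearMap.pi fun B => (restrictAlgHom K B.1).toLinearMap.submoduleMap V
  have hinj : Function.Injective restriction := fun f g hfg => by
    refine Subtype.ext (funext fun x => ?_)
    obtain ⟨B, hB, hx⟩ := P.exists_mem (Finset.mem_univ x)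
    exact congrFun (congrArg Subtype.val (congrFun hfg ⟨B, hB⟩)) ⟨x, hx⟩
  calc finrank K V ≤ finrank K (∀ B : P.parts, V.map (restrictAlgHom K B.1).toLinearMap) :=
        LinearMap.finrank_le_finrank_of_injective hinj
    _ = _ := by
        rw [Module.finrank_pi_fintype]
        exact Finset.sum_coe_sort P.parts fun B =>
          finrank K (V.map (restrictAlgHom K B).toLinearMap)

theorem mul_finrank_map_restrictAlgHom_add_le_card_or [Infinite K] {p : ℕ} [CharP K p]
    {s : Set (α → K)} (hs : ∀ e ∈ s, IsIdempotentElem e)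
    (hsum : ∀ f ∈ Submodule.span K s ^ (p + 1), ∑ x, f x = 0) {B : Finset α}
    (hB : B ∈ (blockPartition (multiplierAlgebra (Submodule.span K s ^ (p + 1)))).parts) :
    p * finrank K ((Submodule.span K s).map (restrictAlgHom K B).toLinearMap) + p ≤ B.card ∨
      p * finrank K ((Submodule.span K s).map (restrictAlgHom K B).toLinearMap) ≤ B.card ∧
        ∀ e ∈ s, (∀ x ∈ B, e x = 0) ∨ (∀ x ∈ B, e x = 1) ∧ B.card = p := by
  have hspan : (Submodule.span K s).map (restrictAlgHom K B).toLinearMap =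
      Submodule.span K (restrictAlgHom K B '' s) := Submodule.map_span _ s
  have hpow : (Submodule.span K s ^ (p + 1)).map (restrictAlgHom K B).toLinearMap =
      Submodule.span K (restrictAlgHom K B '' s) ^ (p + 1) := by
    rw [Submodule.map_pow, hspan]
  have : Nonempty B := (Finpartition.nonempty_of_mem_parts _ hB).to_subtype
  have hrestrict := mul_finrank_span_add_le_card_or_forall_eq_zero_or_eq_one p
    (s := restrictAlgHom K B '' s)
    (Set.forall_mem_image.2 fun e he => (hs e he).map _)
    (fun f hf => sum_eq_zero_of_mem_map_restrictAlgHom hsum hB (hpow ▸ hf))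
    (hpow ▸ multiplierAlgebra_map_restrictAlgHom_eq_bot hB)
  rw [← hspan, Fintype.card_coe, Set.forall_mem_image] at hrestrict
  refine hrestrict.imp_right (And.imp_right fun h e he => (h he).imp ?_ (And.imp_left ?_)) <;>
    exact fun heq x hx => congrFun heq ⟨x, hx⟩

theorem mul_finrank_span_add_le_card_or_exists_finpartition [Infinite K] (p : ℕ) [CharP K p]
    {s : Set (α → K)} (hs : ∀ e ∈ s, IsIdempotentElem e)
    (hsum : ∀ f ∈ Submodule.span K s ^ (p + 1), ∑ x, f x = 0) :
    p * finrank K (Submodule.span K s) + p ≤ Fintype.card α ∨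
      ∃ P : Finpartition (Finset.univ : Finset α), ∀ B ∈ P.parts, ∀ e ∈ s,
        (∀ x ∈ B, e x = 0) ∨ (∀ x ∈ B, e x = 1) ∧ B.card = p := by
  set V := Submodule.span K s
  let P := blockPartition (multiplierAlgebra (V ^ (p + 1)))
  let d (B : Finset α) : ℕ := finrank K (V.map (restrictAlgHom K B).toLinearMap)
  have hblock (B) (hB : B ∈ P.parts) := mul_finrank_map_restrictAlgHom_add_le_card_or hs hsum hB
  have hrank : p * finrank K V ≤ ∑ B ∈ P.parts, p * d B := by
    rw [← Finset.mul_sum]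
    exact Nat.mul_le_mul_left p (finrank_le_sum_finrank_map_restrictAlgHom P V)
  refine or_iff_not_imp_right.2 fun hP => ?_
  have hle : ∀ B ∈ P.parts, p * d B ≤ B.card := fun B hB =>
    (hblock B hB).elim le_of_add_le_left And.left
  obtain ⟨B, hB, hlarge⟩ : ∃ B ∈ P.parts, p * d B + p ≤ B.card := by
    by_contra! hsmall
    exact hP ⟨P, fun B hB => ((hblock B hB).resolve_left (hsmall B hB).not_ge).2⟩
  have hrest : ∑ C ∈ P.parts.erase B, p * d C ≤ ∑ C ∈ P.parts.erase B, C.card :=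
    Finset.sum_le_sum fun C hC => hle C (Finset.mem_of_mem_erase hC)
  rw [← Finset.card_univ, ← P.sum_card_parts]
  rw [← Finset.add_sum_erase _ _ hB] at hrank ⊢
  omega

end Blocks

section Families

variable {α : Type*}

/-- The indicator functions with values in `K` of the members of `F`, whose span turns questions
about `F` into linear algebra. -/
def indicatorFunctions (K : Type*) [Field K] (F : Finset (Finset α)) : Set (α → K) :=
  (fun A : Finset α => (A : Set α).indicator 1) '' F

theorem isIdempotentElem_of_mem_indicatorFunctions {K : Type*} [Field K]
    {F : Finset (Finset α)} : ∀ e ∈ indicatorFunctions K F, IsIdempotentElem e :=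
  Set.forall_mem_image.2 fun A _ => isIdempotentElem_pi_iff.2 fun x => by
    by_cases hx : x ∈ A <;> simp [hx]

theorem card_le_two_pow_finrank_span_indicatorFunctions (K : Type*) [Field K] [Finite α]
    (F : Finset (Finset α)) :
    F.card ≤ 2 ^ finrank K (Submodule.span K (indicatorFunctions K F)) := by
  classical
  let indicatorOne (A : Finset α) : α → K := (A : Set α).indicator 1
  have hinj : Function.Injective indicatorOne := fun A B h =>
    Finset.coe_injective (Set.indicator_one_inj K h)
  have himage : ↑(F.image indicatorOne) = indicatorFunctions K F := Finset.coe_image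
  rw [← Finset.card_image_of_injective F hinj]
  refine card_le_two_pow_finrank (himage ▸ Submodule.subset_span) fun e he => ?_
  exact isIdempotentElem_of_mem_indicatorFunctions e (himage ▸ Finset.mem_coe.2 he)

variable [Fintype α] [DecidableEq α]

theorem sum_eq_zero_of_mem_span_indicatorFunctions_pow {K : Type*} [Field K] {p k : ℕ} [CharP K p]
    {F : Finset (Finset α)}
    (hF : ∀ A : Fin k → Finset α, (∀ i, A i ∈ F) → p ∣ (Finset.univ.inf A).card) :
    ∀ f ∈ Submodule.span K (indicatorFunctions K F) ^ k, ∑ x, f x = 0 := by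
  intro f hf
  rw [Submodule.span_pow] at hf
  induction hf using Submodule.span_induction with
  | mem f hf =>
    obtain ⟨e, he, rfl⟩ := Set.mem_pow_iff_prod.1 hf
    choose A hA hAe using he
    have hprod : ∏ i, e i = ((Finset.univ.inf A : Finset α) : Set α).indicator 1 := by
      funext x
      simp [← hAe, Set.indicator_apply, Finset.mem_inf, Finset.prod_ite_zero]
    rw [hprod]
    simpa [Set.indicator_apply, CharP.cast_eq_zero_iff K p] using hF A hA
  | zero => simp
  | add f g _ _ hf hg => simp [Finset.sum_add_distrib, hf, hg]
  | smul c f _ hf => simp [← Finset.mul_sum, hf]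

theorem eq_sup_filter_subset {P : Finpartition (Finset.univ : Finset α)} {A : Finset α}
    (q : Finset α → Prop) [DecidablePred q] (hA : ∀ B ∈ P.parts, Disjoint B A ∨ B ⊆ A ∧ q B) :
    A = ({B ∈ P.parts.filter q | B ⊆ A} : Finset (Finset α)).sup id := by
  refine le_antisymm (fun x hx => ?_) (Finset.sup_le fun B hB => (Finset.mem_filter.1 hB).2)
  obtain ⟨B, hB, hxB⟩ := P.exists_mem (Finset.mem_univ x)
  obtain ⟨hBA, hq⟩ := (hA B hB).resolve_left fun h => Finset.disjoint_left.1 h hxB hx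
  exact Finset.mem_sup.2 ⟨B, by simp [hB, hBA, hq], hxB⟩

theorem exists_atoms_of_forall_part (K : Type*) [Field K] {p : ℕ} {F : Finset (Finset α)}
    (P : Finpartition (Finset.univ : Finset α))
    (hP : ∀ B ∈ P.parts, ∀ e ∈ indicatorFunctions K F,
        (∀ x ∈ B, e x = 0) ∨ (∀ x ∈ B, e x = 1) ∧ B.card = p) :
    ∃ G atoms : Finset (Finset α),
      ((∀ A ∈ atoms, ∀ B ∈ atoms, A ≠ B → Disjoint A B) ∧
        ∀ S : Finset α, S ∈ G ↔ ∃ B ⊆ atoms, S = B.sup id) ∧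
      (∀ A ∈ atoms, A.card = p) ∧ F ⊆ G := by
  let atoms := P.parts.filter (·.card = p)
  let G := atoms.powerset.image fun T => T.sup id
  have hG : ∀ S, S ∈ G ↔ ∃ T ⊆ atoms, S = T.sup id := fun S => by simp [G, eq_comm]
  refine ⟨G, atoms, ⟨fun A hA B hB => ?_, hG⟩, fun A hA => (Finset.mem_filter.1 hA).2,
    fun A hA => (hG A).2 ⟨_, Finset.filter_subset _ _, eq_sup_filter_subset _ fun B hB => ?_⟩⟩
  · exact P.disjoint (Finset.filter_subset _ _ hA) (Finset.filter_subset _ _ hB)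
  · refine (hP B hB _ ⟨A, hA, rfl⟩).imp (fun h => ?_) (And.imp_left fun h x hx => ?_)
    · refine Finset.disjoint_left.2 fun x hx hxA => ?_
      simpa [hxA] using h x hx
    · by_contra hxA
      simpa [hxA] using h x hx

theorem theorem2_general {p : ℕ} (hp : p.Prime) (F : Finset (Finset α))
    (hF : ∀ A : Fin (p + 1) → Finset α, (∀ i, A i ∈ F) → p ∣ (Finset.univ.inf A).card)
    (hcard : (2 : ℝ) ^ (((Fintype.card α / p : ℕ) : ℤ) - 1) < (F.card : ℝ)) :
    ∃ G atoms : Finset (Finset α),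
      ((∀ A ∈ atoms, ∀ B ∈ atoms, A ≠ B → Disjoint A B) ∧
        ∀ S : Finset α, S ∈ G ↔ ∃ B ⊆ atoms, S = B.sup id) ∧
      (∀ A ∈ atoms, A.card = p) ∧ F ⊆ G := by
  have : Fact p.Prime := ⟨hp⟩
  let K := AlgebraicClosure (ZMod p)
  have : Infinite K := IsAlgClosed.instInfinite
  rcases mul_finrank_span_add_le_card_or_exists_finpartition p (K := K)
    isIdempotentElem_of_mem_indicatorFunctions
    (sum_eq_zero_of_mem_span_indicatorFunctions_pow hF) with hdim | ⟨P, hP⟩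
  · set d := finrank K (Submodule.span K (indicatorFunctions K F))
    have hdiv : d + 1 ≤ Fintype.card α / p :=
      (Nat.le_div_iff_mul_le hp.pos).2 (by linarith)
    have hsmall : (F.card : ℝ) ≤ 2 ^ (((Fintype.card α / p : ℕ) : ℤ) - 1) :=
      calc (F.card : ℝ) ≤ 2 ^ d := by
            exact_mod_cast card_le_two_pow_finrank_span_indicatorFunctions K F
        _ = 2 ^ (d : ℤ) := (zpow_natCast 2 d).symm
        _ ≤ _ := zpow_le_zpow_right₀ one_le_two (by omega)
    exact absurd hcard hsmall.not_gt
  · exact exists_atoms_of_forall_part K P hP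

end Families

theorem theorem2 {n p : ℕ} (hp : p.Prime) (F : Finset (Finset (Fin n)))
    (hF : IsWiseDivisible (p + 1) p F)
    (hcard : (2 : ℝ) ^ (((n / p : ℕ) : ℤ) - 1) < (F.card : ℝ)) :
    ∃ G atoms : Finset (Finset (Fin n)),
      IsAtomicFamily G atoms ∧ (∀ A ∈ atoms, A.card = p) ∧ F ⊆ G :=
  theorem2_general hp F hF (by rwa [Fintype.card_fin])
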